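/- Proposition 6.13 (omega stable). Let $L^{pr}$ be the signature of continuous first order logic with constants $0,1$, a unary operation ${}^c$, binary operations $\cap,\cup$, a unary $[0,1]$-valued predicate $\mu$ and a $[0,1]$-valued metric $d$, with moduli of uniform continuity $\Delta(\varepsilon)=\varepsilon$ for ${}^c$ and $\mu$, and $\Delta(\varepsilon)=\varepsilon/2$ for $\cap$ and $\cup$. Structures are complete metric spaces, and formulas are built from atomic formulas using all continuous connectives $[0,1]^k\to[0,1]$ and the quantifiers $\sup$ and $\inf$. Let $APA$ be the $L^{pr}$-theory whose axioms are the axioms of Boolean algebras; $\mu(0)=0$ and $\mu(1)=1$; monotonicity and modularity of $\mu$ (that is, $\mu(x\cap y)\le\mu(x)\le\mu(x\cup y)$ and $\mu(x\cup y)+\mu(x\cap y)=\mu(x)+\mu(y)$); $d(x,y)=\mu(x\triangle y)$; and atomlessness, $\sup_x\inf_y|\mu(x\cap y)-\mu(x\cap y^c)|=0$. The theory $APA$ is $\omega$-stable. That is, for every model $\mathcal M$ of $APA$ and every countable set $C\subseteq M$, the space $S_1(C)$ of complete $1$-types over $C$ has a countable subset which is dense with respect to the induced metric $$d(p,q)=\inf\{\,d(a,b)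 : a\models p,\ b\models q\,\}.$$ Here $S_1(C)$ is the set of types over $C$ of elements of models of the complete theory of $(\mathcal M,c)_{c\in C}$, and the infimum is over all pairs of realizations $a$ of $p$ and $b$ of $q$ in a common model of that theory (equivalently, in a sufficiently saturated elementary extension of $\mathcal M$). -/

import Mathlib

universe u

/-!
Continuous first order logic for the signature of probability algebras: constants `0, 1`,
a unary operation (complement), binary operations (intersection, union), a unary predicate (the
measure) and the metric, which is also a predicate.  All predicates take values in `[0,1]`.
-/

namespace ProbAlg

/-- A metric structure for the signature of probability algebras: a complete metric space of
diameter at most `1` with interpretations of the symbols that respect the prescribed moduli of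
uniform continuity (`ε` for complement and measure, `ε / 2` for the two binary operations). -/
class MetricStructure (M : Type u) extends MetricSpace M, CompleteSpace M where
  zero : M
  one : M
  compl : M → M
  inter : M → M → M
  union : M → M → M
  measure : M → unitInterval
  dist_le_one : ∀ x y : M, dist x y ≤ 1
  compl_modulus : ∀ ε > 0, ∀ x y : M, dist x y < ε → dist (compl x) (compl y) ≤ ε
  inter_modulus : ∀ ε > 0, ∀ x x' y y' : M, dist x x' < ε / 2 → dist y y' < ε / 2 →
    dist (inter x y) (inter x' y') ≤ ε
  union_modulus : ∀ ε > 0, ∀ x x' y y' : M, dist x x' < ε / 2 → dist y y' < ε / 2 →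
    dist (union x y) (union x' y') ≤ ε
  measure_modulus : ∀ ε > 0, ∀ x y : M, dist x y < ε → |(measure x : ℝ) - measure y| ≤ ε

/-- Terms with variables from `α`. -/
inductive Term (α : Type u) : Type u
  | var (a : α) : Term α
  | zero : Term α
  | one : Term α
  | compl (t : Term α) : Term α
  | inter (s t : Term α) : Term α
  | union (s t : Term α) : Term α

/-- The value of a term under an assignment of its variables. -/
def Term.eval {α : Type u} {M : Type*} [MetricStructure M] (v : α → M) : Term α → M
  | .var a => v a
  | .zero => MetricStructure.zero
  | .one => MetricStructure.one
  | .compl t => MetricStructure.compl (t.eval v)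
  | .inter s t => MetricStructure.inter (s.eval v) (t.eval v)
  | .union s t => MetricStructure.union (s.eval v) (t.eval v)

/-- Formulas of continuous logic.  The elements of `α` serve as names of parameters, and there are
`n` further variables `x_0, ..., x_{n-1}`.  Every continuous function `[0,1]^k → [0,1]` is a
connective; `sup` and `inf` quantify over the last variable. -/
inductive Formula (α : Type u) : ℕ → Type u
  | measure {n : ℕ} (t : Term (α ⊕ Fin n)) : Formula α n
  | dist {n : ℕ} (s t : Term (α ⊕ Fin n)) : Formula α n
  | conn {n k : ℕ} (c : C(Fin k → unitInterval, unitInterval)) (φ : Fin k → Formula α n) :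
      Formula α n
  | sup {n : ℕ} (φ : Formula α (n + 1)) : Formula α n
  | inf {n : ℕ} (φ : Formula α (n + 1)) : Formula α n

/-- The value in `[0,1]` of a formula in `M`, with parameters interpreted by `v` and variables
by `x`. -/
noncomputable def Formula.eval {α : Type u} {M : Type*} [MetricStructure M] (v : α → M) :
    {n : ℕ} → Formula α n → (Fin n → M) → unitInterval
  | _, .measure t, x => MetricStructure.measure (t.eval (Sum.elim v x))
  | _, .dist s t, x =>
      ⟨Dist.dist (s.eval (Sum.elim v x)) (t.eval (Sum.elim v x)),
        dist_nonneg, MetricStructure.dist_le_one _ _⟩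
  | _, .conn c φ, x => c fun i => (φ i).eval v x
  | _, .sup φ, x => ⨆ y : M, φ.eval v (Fin.snoc x y)
  | _, .inf φ, x => ⨅ y : M, φ.eval v (Fin.snoc x y)

/-- Sentences without parameters. -/
abbrev Sentence : Type := Formula Empty 0

/-- `M` satisfies the theory `T`.  A theory is a set of conditions of the form `σ = 0`, given by
the set of the sentences `σ`. -/
def Models (M : Type*) [MetricStructure M] (T : Set Sentence) : Prop :=
  ∀ σ ∈ T, σ.eval (Empty.elim : Empty → M) Fin.elim0 = 0

/-! ### The theory of atomless probability algebras -/

/-- The connective `|s - t|`. -/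
noncomputable def absDiff {n : ℕ} (φ ψ : Formula Empty n) : Formula Empty n :=
  .conn ⟨fun p => Set.projIcc 0 1 zero_le_one |(p 0 : ℝ) - (p 1 : ℝ)|,
    continuous_projIcc.comp (by fun_prop)⟩ ![φ, ψ]

/-- The connective `max (s - t) 0`. -/
noncomputable def dotMinus {n : ℕ} (φ ψ : Formula Empty n) : Formula Empty n :=
  .conn ⟨fun p => Set.projIcc 0 1 zero_le_one ((p 0 : ℝ) - (p 1 : ℝ)),
    continuous_projIcc.comp (by fun_prop)⟩ ![φ, ψ]

/-- The constant `1` as a connective without arguments. -/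
def oneFormula {n : ℕ} : Formula Empty n :=
  .conn (ContinuousMap.const _ 1) Fin.elim0

/-- The variable `x_i`. -/
def X {n : ℕ} (i : Fin n) : Term (Empty ⊕ Fin n) := .var (.inr i)

/-- The term for the symmetric difference. -/
def symmDiffTerm {α : Type u} (s t : Term α) : Term α :=
  .union (.inter s t.compl) (.inter s.compl t)

/-- The axioms of Boolean algebras. -/
def booleanAxioms : Set Sentence :=
  { .sup (.sup (.dist (.union (X 0) (X 1)) (.union (X 1) (X 0)))),
    .sup (.sup (.dist (.inter (X 0) (X 1)) (.inter (X 1) (X 0)))),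
    .sup (.sup (.sup (.dist (.union (.union (X 0) (X 1)) (X 2))
      (.union (X 0) (.union (X 1) (X 2)))))),
    .sup (.sup (.sup (.dist (.inter (.inter (X 0) (X 1)) (X 2))
      (.inter (X 0) (.inter (X 1) (X 2)))))),
    .sup (.sup (.dist (.union (X 0) (.inter (X 0) (X 1))) (X 0))),
    .sup (.sup (.dist (.inter (X 0) (.union (X 0) (X 1))) (X 0))),
    .sup (.sup (.sup (.dist (.inter (X 0) (.union (X 1) (X 2)))
      (.union (.inter (X 0) (X 1)) (.inter (X 0) (X 2)))))),
    .sup (.sup (.sup (.dist (.union (X 0) (.inter (X 1) (X 2)))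
      (.inter (.union (X 0) (X 1)) (.union (X 0) (X 2)))))),
    .sup (.dist (.union (X 0) (X 0).compl) .one),
    .sup (.dist (.inter (X 0) (X 0).compl) .zero) }

/-- The axioms for the measure. -/
noncomputable def measureAxioms : Set Sentence :=
  { .measure .zero,
    absDiff (.measure .one) oneFormula,
    .sup (.sup (dotMinus (.measure (.inter (X 0) (X 1))) (.measure (X 0)))),
    .sup (.sup (dotMinus (.measure (X 0)) (.measure (.union (X 0) (X 1))))),
    .sup (.sup (absDiff
      (dotMinus (.measure (X 0)) (.measure (.inter (X 0) (X 1))))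
      (dotMinus (.measure (.union (X 0) (X 1))) (.measure (X 1))))) }

/-- The metric is the measure of the symmetric difference. -/
noncomputable def metricAxiom : Sentence :=
  .sup (.sup (absDiff (.dist (X 0) (X 1)) (.measure (symmDiffTerm (X 0) (X 1)))))

/-- The theory of probability algebras. -/
noncomputable def probAlgTheory : Set Sentence :=
  booleanAxioms ∪ measureAxioms ∪ {metricAxiom}

/-- Atomlessness: `sup_x inf_y |μ(x ∩ y) - μ(x ∩ yᶜ)| = 0`. -/
noncomputable def atomlessAxiom : Sentence :=
  .sup (.inf (absDiff (.measure (.inter (X 0) (X 1))) (.measure (.inter (X 0) (X 1).compl))))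

/-- The theory `APA` of atomless probability algebras. -/
noncomputable def APA : Set Sentence := probAlgTheory ∪ {atomlessAxiom}

/-! ### Types over a parameter set and `ω`-stability -/

section Types

variable {M : Type u} [MetricStructure M]

/-- `(N, (e c)_{c ∈ C})` is a model of the complete theory of `(M, c)_{c ∈ C}`: every sentence with
parameters from `C` has the same value in both. -/
def IsModelOver (C : Set M) (N : Type u) [MetricStructure N] (e : C → N) : Prop :=
  ∀ σ : Formula C 0, σ.eval e Fin.elim0 = σ.eval (Subtype.val : C → M) Fin.elim0

/-- The type of `a` over the parameters `e c`: the set of all formulas `φ(x)` with parameters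
such that `a` satisfies the condition `φ(x) = 0`. -/
def tp {C : Set M} {N : Type u} [MetricStructure N] (e : C → N) (a : N) : Set (Formula C 1) :=
  {φ | φ.eval e ![a] = 0}

/-- The space `S_1(C)` of complete 1-types over `C`: the types of elements of
arbitrary models of the theory of `(M, c)_{c ∈ C}`. -/
def TypeSpace (C : Set M) : Set (Set (Formula C 1)) :=
  {p | ∃ (N : Type u) (_ : MetricStructure N) (e : C → N) (a : N),
    IsModelOver C N e ∧ tp e a = p}

/-- The induced distance of two 1-types over `C`: the infimum of `d(a, b)` over all realizations
`a` of `p` and `b` of `q` in a common model of the theory of `(M, c)_{c ∈ C}`.  (Every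
pair `(a, b)` in such a model has the same type over `C` as a pair in a sufficiently saturated
model, so the infimum within one such model is the same.) -/
noncomputable def typeDist (C : Set M) (p q : Set (Formula C 1)) : ENNReal :=
  sInf {r | ∃ (N : Type u) (_ : MetricStructure N) (e : C → N) (a b : N),
    IsModelOver C N e ∧ tp e a = p ∧ tp e b = q ∧ r = edist a b}

end Types

/-- `T` is `ω`-stable: for every model `M` of `T` and every countable set `C` of parameters in `M`,
the space of 1-types over `C` has a countable subset that is dense for the induced metric. -/
def OmegaStable (T : Set Sentence) : Prop :=
  ∀ (M : Type u) [MetricStructure M], Models M T → ∀ C : Set M, C.Countable →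
    ∃ D ⊆ TypeSpace C, D.Countable ∧
      ∀ p ∈ TypeSpace C, ∀ ε > 0, ∃ q ∈ D, typeDist C p q < ε

end ProbAlg

/-! Over a countable `C`, a single separable model of `APA` realizes every type in S_1(C); the types
of the points of a countable dense subset are then dense.

The model. Sending a Boolean term over `C` to its measure is a finitely additive measure, which
extends to a probability measure `ν` on the Cantor space `C → Bool` (`exists_measure_cyl`). The
measure algebra of `ν` times Lebesgue measure on [0,1] is complete, atomless because of the interval
factor (`prodUnit_halving`), and separable because `C` is countable. In it the coordinate cylinders
stand for the elements of `C`.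

Quantifier elimination (`Agree.eval_eq`). Assignments giving equal measures to all terms give equal
values to all formulas. This is a back-and-forth argument: a new element matters only through the
measures it cuts off on the finitely many cells of the parameters, and elements of every prescribed
measure exist (`exists_le_meas_eq`). Hence the type of `a` over `C` is the function sending a term t
to μ(t ∩ a).

Realization (`exists_realization`). This function is a measure `ρ ≤ ν`, so it has a density with
values in [0,1] by Radon-Nikodym, and the region under the graph of the density realizes the type.
-/

namespace ProbAlg

open MetricStructure

/-- The axioms of atomless probability algebras, spelled out for a metric structure. -/
class IsAPA (M : Type*) [MetricStructure M] : Prop where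
  union_comm : ∀ x y : M, union x y = union y x
  inter_comm : ∀ x y : M, inter x y = inter y x
  union_assoc : ∀ x y z : M, union (union x y) z = union x (union y z)
  inter_assoc : ∀ x y z : M, inter (inter x y) z = inter x (inter y z)
  union_inter_self : ∀ x y : M, union x (inter x y) = x
  inter_union_self : ∀ x y : M, inter x (union x y) = x
  inter_union_distrib : ∀ x y z : M, inter x (union y z) = union (inter x y) (inter x z)
  union_inter_distrib : ∀ x y z : M, union x (inter y z) = inter (union x y) (union x z)
  union_compl : ∀ x : M, union x (compl x) = one
  inter_compl : ∀ x : M, inter x (compl x) = zero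
  measure_zero : (measure (zero : M) : ℝ) = 0
  measure_one : (measure (one : M) : ℝ) = 1
  modular : ∀ x y : M, (measure (union x y) : ℝ) + measure (inter x y) = measure x + measure y
  dist_eq : ∀ x y : M, dist x y = measure (union (inter x (compl y)) (inter (compl x) y))
  atomless : ∀ x : M, ∀ ε : ℝ, 0 < ε →
    ∃ y : M, |(measure (inter x y) : ℝ) - measure (inter x (compl y))| < ε

/-! ### From continuous-logic conditions to algebraic identities. -/

section Extraction

variable {M : Type*} [MetricStructure M]

lemma iSup_eq_zero {ι : Sort*} {f : ι → unitInterval} (h : ⨆ i, f i = 0) (i : ι) : f i = 0 :=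
  le_antisymm (h ▸ le_iSup f i) unitInterval.nonneg'

lemma eval_inf {α : Type u} {n : ℕ} (φ : Formula α (n + 1)) (v : α → M) (x : Fin n → M) :
    (Formula.inf φ).eval v x = ⨅ y : M, φ.eval v (Fin.snoc x y) := rfl

lemma eval_dist_eq_zero {α : Type u} {n : ℕ} {s t : Term (α ⊕ Fin n)} {v : α → M} {x : Fin n → M}
    (h : (Formula.dist s t).eval v x = 0) :
    s.eval (Sum.elim v x) = t.eval (Sum.elim v x) :=
  dist_eq_zero.1 (congrArg Subtype.val h)

lemma eval_absDiff {n : ℕ} (φ ψ : Formula Empty n) (v : Empty → M) (x : Fin n → M) :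
    ((absDiff φ ψ).eval v x : ℝ) = |(φ.eval v x : ℝ) - ψ.eval v x| := by
  have h1 := (φ.eval v x).2
  have h2 := (ψ.eval v x).2
  have h3 : |(φ.eval v x : ℝ) - ψ.eval v x| ≤ 1 := abs_le.2 ⟨by linarith [h1.1, h2.2],
    by linarith [h1.2, h2.1]⟩
  simp [absDiff, Formula.eval, Set.projIcc, h3]

lemma eval_dotMinus {n : ℕ} (φ ψ : Formula Empty n) (v : Empty → M) (x : Fin n → M) :
    ((dotMinus φ ψ).eval v x : ℝ) = max ((φ.eval v x : ℝ) - ψ.eval v x) 0 := by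
  have h1 := (φ.eval v x).2
  have h2 := (ψ.eval v x).2
  have h3 : (φ.eval v x : ℝ) - ψ.eval v x ≤ 1 := by linarith [h1.2, h2.1]
  simp [dotMinus, Formula.eval, Set.projIcc, h3, max_comm]

lemma IsAPA.of_models (h : Models M APA) : IsAPA M := by
  have hb : ∀ σ ∈ booleanAxioms, σ.eval (Empty.elim : Empty → M) Fin.elim0 = 0 :=
    fun σ hσ => h σ (Or.inl (Or.inl (Or.inl hσ)))
  have hm : ∀ σ ∈ measureAxioms, σ.eval (Empty.elim : Empty → M) Fin.elim0 = 0 :=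
    fun σ hσ => h σ (Or.inl (Or.inl (Or.inr hσ)))
  have hd := h metricAxiom (Or.inl (Or.inr rfl))
  have ha := h atomlessAxiom (Or.inr rfl)
  simp only [booleanAxioms, measureAxioms, Set.mem_insert_iff, Set.mem_singleton_iff,
    forall_eq_or_imp, forall_eq] at hb hm
  obtain ⟨b1, b2, b3, b4, b5, b6, b7, b8, b9, b10⟩ := hb
  obtain ⟨m1, m2, m3, m4, m5⟩ := hm
  -- Modularity is axiomatized with truncated subtraction; the two monotonicity facts show that
  -- nothing is truncated.
  have inter_le : ∀ x y : M, (measure (inter x y) : ℝ) ≤ measure x := fun x y => by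
    have := congrArg Subtype.val (iSup_eq_zero (iSup_eq_zero m3 x) y)
    rw [eval_dotMinus] at this
    have := (le_max_left _ _).trans this.le
    exact sub_nonpos.1 this
  have le_union : ∀ x y : M, (measure x : ℝ) ≤ measure (union x y) := fun x y => by
    have := congrArg Subtype.val (iSup_eq_zero (iSup_eq_zero m4 x) y)
    rw [eval_dotMinus] at this
    have := (le_max_left _ _).trans this.le
    exact sub_nonpos.1 this
  have uc : ∀ x y : M, union x y = union y x := fun x y =>
    eval_dist_eq_zero (iSup_eq_zero (iSup_eq_zero b1 x) y)
  refine ⟨uc,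
    fun x y => eval_dist_eq_zero (iSup_eq_zero (iSup_eq_zero b2 x) y),
    fun x y z => eval_dist_eq_zero (iSup_eq_zero (iSup_eq_zero (iSup_eq_zero b3 x) y) z),
    fun x y z => eval_dist_eq_zero (iSup_eq_zero (iSup_eq_zero (iSup_eq_zero b4 x) y) z),
    fun x y => eval_dist_eq_zero (iSup_eq_zero (iSup_eq_zero b5 x) y),
    fun x y => eval_dist_eq_zero (iSup_eq_zero (iSup_eq_zero b6 x) y),
    fun x y z => eval_dist_eq_zero (iSup_eq_zero (iSup_eq_zero (iSup_eq_zero b7 x) y) z),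
    fun x y z => eval_dist_eq_zero (iSup_eq_zero (iSup_eq_zero (iSup_eq_zero b8 x) y) z),
    fun x => eval_dist_eq_zero (iSup_eq_zero b9 x),
    fun x => eval_dist_eq_zero (iSup_eq_zero b10 x),
    congrArg Subtype.val m1, ?_, fun x y => ?_, fun x y => ?_, fun x ε hε => ?_⟩
  · have := congrArg Subtype.val m2
    rw [eval_absDiff] at this
    exact sub_eq_zero.1 (abs_eq_zero.1 this)
  · have := congrArg Subtype.val (iSup_eq_zero (iSup_eq_zero m5 x) y)
    rw [eval_absDiff] at this
    have := sub_eq_zero.1 (abs_eq_zero.1 this)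
    rw [eval_dotMinus, eval_dotMinus] at this
    change max ((measure x : ℝ) - measure (inter x y)) 0
      = max ((measure (union x y) : ℝ) - measure y) 0 at this
    rw [max_eq_left (sub_nonneg.2 (inter_le x y)),
      max_eq_left (sub_nonneg.2 (uc x y ▸ le_union y x))] at this
    linarith
  · have := congrArg Subtype.val (iSup_eq_zero (iSup_eq_zero hd x) y)
    rw [eval_absDiff] at this
    exact sub_eq_zero.1 (abs_eq_zero.1 this)
  · have := iSup_eq_zero ha x
    rw [eval_inf] at this
    -- The infimum need not be attained, so only approximate halving is available; `min ε 1` keeps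
    -- the bound in the unit interval.
    obtain ⟨y, hy⟩ := iInf_lt_iff.1 (this.trans_lt
      (show (0 : unitInterval) < ⟨min ε 1, by positivity, min_le_right _ _⟩ from
        Subtype.mk_lt_mk.2 (by positivity)))
    refine ⟨y, ?_⟩
    have hy' := Subtype.coe_lt_coe.2 hy
    rw [eval_absDiff] at hy'
    exact hy'.trans_le (min_le_left _ _)

end Extraction

/-! ### Measured Boolean algebras and elements of prescribed measure. -/

section Algebra

variable {M : Type*} [MetricStructure M]

/-- The measure as a real number. -/
def meas (x : M) : ℝ := measure x

lemma meas_nonneg (x : M) : 0 ≤ meas x := (measure x).2.1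

variable [IsAPA M]

instance (priority := 100) : Lattice M :=
  letI : Max M := ⟨union⟩
  letI : Min M := ⟨inter⟩
  Lattice.mk' IsAPA.union_comm IsAPA.union_assoc IsAPA.inter_comm IsAPA.inter_assoc
    IsAPA.union_inter_self IsAPA.inter_union_self

instance (priority := 100) : BooleanAlgebra M :=
  { (inferInstance : Lattice M) with
    le_sup_inf := fun x y z => (IsAPA.union_inter_distrib x y z).ge
    compl := compl
    top := one
    bot := zero
    inf_compl_le_bot := fun x => (IsAPA.inter_compl x).le
    top_le_sup_compl := fun x => (IsAPA.union_compl x).ge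
    le_top := fun x => by
      have : one = (x ⊔ compl x : M) := (IsAPA.union_compl x).symm
      change x ≤ one
      rw [this]; exact le_sup_left
    bot_le := fun x => by
      have : zero = (x ⊓ compl x : M) := (IsAPA.inter_compl x).symm
      change zero ≤ x
      rw [this]; exact inf_le_left }

lemma meas_bot : meas (⊥ : M) = 0 := IsAPA.measure_zero

lemma meas_top : meas (⊤ : M) = 1 := IsAPA.measure_one

lemma meas_sup_add_inf (x y : M) : meas (x ⊔ y) + meas (x ⊓ y) = meas x + meas y :=
  IsAPA.modular x y

lemma meas_sup {x y : M} (h : Disjoint x y) : meas (x ⊔ y) = meas x + meas y := by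
  rw [← meas_sup_add_inf, h.eq_bot, meas_bot, add_zero]

lemma meas_inf_add_inf_compl (x y : M) : meas (x ⊓ y) + meas (x ⊓ yᶜ) = meas x := by
  rw [← meas_sup, ← inf_sup_left, sup_compl_eq_top, inf_top_eq]
  exact disjoint_compl_right.mono inf_le_right inf_le_right

lemma meas_mono {x y : M} (h : x ≤ y) : meas x ≤ meas y := by
  have := meas_inf_add_inf_compl y x
  rw [inf_eq_right.2 h] at this
  linarith [meas_nonneg (y ⊓ xᶜ)]

lemma dist_eq_meas (x y : M) : dist x y = meas ((x ⊓ yᶜ) ⊔ (xᶜ ⊓ y)) := IsAPA.dist_eq x y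

lemma dist_eq_add (x y : M) : dist x y = meas (x ⊓ yᶜ) + meas (y ⊓ xᶜ) := by
  rw [dist_eq_meas, meas_sup, inf_comm xᶜ]
  exact (disjoint_compl_right (a := x)).mono inf_le_left inf_le_left

lemma abs_meas_sub_le (x y : M) : |meas x - meas y| ≤ dist x y := by
  have h1 := meas_inf_add_inf_compl x y
  have h2 := meas_inf_add_inf_compl y x
  rw [inf_comm] at h2
  rw [dist_eq_add, abs_le]
  constructor <;> linarith [meas_nonneg (x ⊓ yᶜ), meas_nonneg (y ⊓ xᶜ)]

lemma dist_of_le {x y : M} (h : x ≤ y) : dist x y = meas y - meas x := by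
  have h2 := meas_inf_add_inf_compl y x
  rw [inf_eq_right.2 h] at h2
  rw [dist_eq_add, (disjoint_compl_right_iff.2 h).eq_bot, meas_bot]
  linarith

lemma dist_inf_le {x l b : M} (h : l ≤ b) : dist (x ⊓ b) l ≤ dist x l := by
  rw [dist_eq_add, dist_eq_add]
  refine add_le_add (meas_mono (inf_le_inf_right _ inf_le_left)) (meas_mono ?_)
  rw [compl_inf, inf_sup_left, (disjoint_compl_right_iff.2 h).eq_bot, sup_bot_eq]

/-- Bisection with an approximate half: if the gap g between `l` and `u` is split with error below
g/2, each piece has measure below 3g/4. Adding one piece to `l` gives a new lower or a new upper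
bound, according to the side of `r` on which its measure falls. -/
lemma exists_shrink {l u : M} (hlu : l ≤ u) {r : ℝ} (hl : meas l ≤ r) (hu : r ≤ meas u) :
    ∃ l' u' : M, l ≤ l' ∧ l' ≤ u' ∧ u' ≤ u ∧ meas l' ≤ r ∧ r ≤ meas u' ∧
      meas u' - meas l' ≤ (meas u - meas l) * (3 / 4) := by
  rcases (sub_nonneg.2 (meas_mono hlu)).eq_or_lt with h0 | h0
  · exact ⟨l, u, le_rfl, hlu, le_rfl, hl, hu, by rw [← h0]; simp⟩
  obtain ⟨y, hy⟩ := IsAPA.atomless (u ⊓ lᶜ) ((meas u - meas l) / 2) (by linarith)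
  change |meas (u ⊓ lᶜ ⊓ y) - meas (u ⊓ lᶜ ⊓ yᶜ)| < _ at hy
  have h1 := meas_inf_add_inf_compl u l
  rw [inf_eq_right.2 hlu] at h1
  have h2 := meas_inf_add_inf_compl (u ⊓ lᶜ) y
  rw [abs_lt] at hy
  have h3 : meas (l ⊔ (u ⊓ lᶜ ⊓ y)) = meas l + meas (u ⊓ lᶜ ⊓ y) := meas_sup
    ((disjoint_compl_right (a := l)).mono_right (inf_le_left.trans inf_le_right))
  have h4 : l ⊔ (u ⊓ lᶜ ⊓ y) ≤ u := sup_le hlu (inf_le_left.trans inf_le_left)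
  rcases le_total (meas (l ⊔ (u ⊓ lᶜ ⊓ y))) r with h | h
  · exact ⟨_, u, le_sup_left, h4, le_rfl, h, hu, by linarith⟩
  · exact ⟨l, _, le_rfl, le_sup_left, h4, hl, h, by linarith⟩

/-- Completeness and atomlessness give elements of every prescribed measure. -/
lemma exists_le_meas_eq (b : M) {r : ℝ} (h0 : 0 ≤ r) (hr : r ≤ meas b) :
    ∃ y ≤ b, meas y = r := by
  let S := {p : M × M // p.1 ≤ p.2 ∧ p.2 ≤ b ∧ meas p.1 ≤ r ∧ r ≤ meas p.2}
  have step : ∀ p : S, ∃ q : S, p.1.1 ≤ q.1.1 ∧ q.1.2 ≤ p.1.2 ∧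
      meas q.1.2 - meas q.1.1 ≤ (meas p.1.2 - meas p.1.1) * (3 / 4) := by
    rintro ⟨⟨l, u⟩, h1, h2, h3, h4⟩
    obtain ⟨l', u', a1, a2, a3, a4, a5, a6⟩ := exists_shrink h1 h3 h4
    exact ⟨⟨(l', u'), a2, a3.trans h2, a4, a5⟩, a1, a3, a6⟩
  choose f hf1 hf2 hf3 using step
  let p : ℕ → S := fun n => f^[n] ⟨(⊥, b), bot_le, le_rfl, by rw [meas_bot]; exact h0, hr⟩
  have hp : ∀ n, p (n + 1) = f (p n) := fun n => Function.iterate_succ_apply' f n _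
  have gap : ∀ n, meas (p n).1.2 - meas (p n).1.1 ≤ (3 / 4 : ℝ) ^ n := by
    intro n
    induction n with
    | zero =>
      change meas b - meas ⊥ ≤ _
      rw [meas_bot, pow_zero, ← meas_top (M := M)]
      linarith [meas_mono (le_top : b ≤ ⊤)]
    | succ n ih =>
      rw [hp, pow_succ]
      exact (hf3 _).trans (by gcongr)
  have hle : ∀ n, (p n).1.1 ≤ b := fun n => (p n).2.1.trans (p n).2.2.1
  have hd : ∀ n, dist (p n).1.1 (p (n + 1)).1.1 ≤ 1 * (3 / 4 : ℝ) ^ n := fun n => by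
    rw [dist_of_le (hp n ▸ hf1 _), one_mul]
    linarith [gap n, (p n).2.2.2.2, (p (n + 1)).2.2.2.1]
  obtain ⟨y, hy⟩ := cauchySeq_tendsto_of_complete
    (cauchySeq_of_le_geometric (3 / 4 : ℝ) 1 (by norm_num) hd)
  -- Cutting the limit by `b` puts it below `b` at once, and by `dist_inf_le` brings it no further
  -- from the approximants.
  refine ⟨y ⊓ b, inf_le_right, ?_⟩
  have key : ∀ n, |meas (y ⊓ b) - r| ≤ dist y (p n).1.1 + (3 / 4 : ℝ) ^ n := fun n => by
    have h1 := (abs_meas_sub_le (y ⊓ b) (p n).1.1).trans (dist_inf_le (hle n))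
    have h2 := gap n
    have h3 := (p n).2.2.2.1
    have h4 := (p n).2.2.2.2
    rw [abs_le] at h1 ⊢
    constructor <;> linarith
  have lim : Filter.Tendsto (fun n => dist y (p n).1.1 + (3 / 4 : ℝ) ^ n) Filter.atTop
      (nhds (0 + 0)) := by
    refine Filter.Tendsto.add ?_ (tendsto_pow_atTop_nhds_zero_of_lt_one (by norm_num) (by norm_num))
    simp_rw [dist_comm y]
    exact tendsto_iff_dist_tendsto_zero.1 hy
  rw [add_zero] at lim
  have := ge_of_tendsto' lim key
  exact sub_eq_zero.1 (abs_eq_zero.1 (le_antisymm this (abs_nonneg _)))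

end Algebra

end ProbAlg

/-! ### Quantifier elimination by back-and-forth. -/

namespace ProbAlg

open MetricStructure

section Matching

variable {M N : Type*} [MetricStructure M] [MetricStructure N] [IsAPA M] [IsAPA N]

/-- Elements that miss a cell or contain it form a subalgebra; the two sides are carried together so
that they fall under the same alternative. -/
lemma eval_dichotomy {ι : Type u} {w : ι → M} {w' : ι → N} {b : M} {b' : N}
    (h : ∀ i, (b ⊓ w i = ⊥ ∧ b' ⊓ w' i = ⊥) ∨ (b ≤ w i ∧ b' ≤ w' i)) (t : Term ι) :
    (b ⊓ t.eval w = ⊥ ∧ b' ⊓ t.eval w' = ⊥) ∨ (b ≤ t.eval w ∧ b' ≤ t.eval w') := by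
  induction t with
  | var i => exact h i
  | zero => exact Or.inl ⟨inf_bot_eq _, inf_bot_eq _⟩
  | one => exact Or.inr ⟨le_top, le_top⟩
  | compl t ih =>
    change (b ⊓ (t.eval w)ᶜ = ⊥ ∧ b' ⊓ (t.eval w')ᶜ = ⊥) ∨ (b ≤ (t.eval w)ᶜ ∧ b' ≤ (t.eval w')ᶜ)
    simp only [← disjoint_iff, disjoint_compl_right_iff, le_compl_iff_disjoint_right] at ih ⊢
    exact ih.symm
  | inter s t ihs iht =>
    change (b ⊓ (s.eval w ⊓ t.eval w) = ⊥ ∧ b' ⊓ (s.eval w' ⊓ t.eval w') = ⊥) ∨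
      (b ≤ s.eval w ⊓ t.eval w ∧ b' ≤ s.eval w' ⊓ t.eval w')
    simp only [← disjoint_iff] at ihs iht ⊢
    rcases ihs with hs | hs
    · exact Or.inl ⟨hs.1.mono_right inf_le_left, hs.2.mono_right inf_le_left⟩
    rcases iht with ht | ht
    · exact Or.inl ⟨ht.1.mono_right inf_le_right, ht.2.mono_right inf_le_right⟩
    · exact Or.inr ⟨le_inf hs.1 ht.1, le_inf hs.2 ht.2⟩
  | union s t ihs iht =>
    change (b ⊓ (s.eval w ⊔ t.eval w) = ⊥ ∧ b' ⊓ (s.eval w' ⊔ t.eval w') = ⊥) ∨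
      (b ≤ s.eval w ⊔ t.eval w ∧ b' ≤ s.eval w' ⊔ t.eval w')
    simp only [← disjoint_iff, disjoint_sup_right] at ihs iht ⊢
    rcases ihs with hs | hs
    · rcases iht with ht | ht
      · exact Or.inl ⟨⟨hs.1, ht.1⟩, hs.2, ht.2⟩
      · exact Or.inr ⟨le_sup_of_le_right ht.1, le_sup_of_le_right ht.2⟩
    · exact Or.inr ⟨le_sup_of_le_left hs.1, le_sup_of_le_left hs.2⟩

/-- The extension step: if `w` and `w'` generate isomorphic measured algebras inside the cells
`b`, `b'`, and all but finitely many of them are trivial there, then every `y` has a counterpart. -/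
lemma exists_matching {ι : Type u} (F : Finset ι) (w : ι → M) (w' : ι → N) (y : M) :
    ∀ (b : M) (b' : N),
      (∀ i ∉ F, (b ⊓ w i = ⊥ ∧ b' ⊓ w' i = ⊥) ∨ (b ≤ w i ∧ b' ≤ w' i)) →
      (∀ t : Term ι, meas (b ⊓ t.eval w) = meas (b' ⊓ t.eval w')) →
      ∃ y' ≤ b', ∀ t : Term ι, meas (b ⊓ t.eval w ⊓ y) = meas (t.eval w' ⊓ y') := by
  classical
  induction F using Finset.induction with
  | empty =>
    intro b b' h agree
    have hb : meas b = meas b' := by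
      have := agree .one
      change meas (b ⊓ ⊤) = meas (b' ⊓ ⊤) at this
      rwa [inf_top_eq, inf_top_eq] at this
    -- No term splits the cell any more, so the measure of `b ⊓ y` is all that has to be copied.
    obtain ⟨y', hy', hr⟩ := exists_le_meas_eq b' (meas_nonneg (b ⊓ y))
      (hb ▸ meas_mono inf_le_left)
    refine ⟨y', hy', fun t => ?_⟩
    rcases eval_dichotomy (fun i => h i (by simp)) t with ht | ht
    · have h0 : t.eval w' ⊓ y' = ⊥ := le_bot_iff.1 ((inf_le_inf_left (t.eval w') hy').trans
        (inf_comm b' _ ▸ ht.2.le))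
      rw [ht.1, bot_inf_eq, h0, meas_bot, meas_bot]
    · rw [inf_eq_left.2 ht.1, inf_eq_right.2 (hy'.trans ht.2), hr]
  | insert i F hi ih =>
    intro b b' h agree
    -- The cell is split along `w i`. On either half the generator `i` is trivial, so the induction
    -- hypothesis applies with `F`; the two disjoint solutions are then joined.
    have side : ∀ (c : M) (c' : N) (s : Term ι), s.eval w = c → s.eval w' = c' →
        ((c = w i ∧ c' = w' i) ∨ (c = (w i)ᶜ ∧ c' = (w' i)ᶜ)) →
        ∃ y' ≤ b' ⊓ c', ∀ t : Term ι, meas (b ⊓ c ⊓ t.eval w ⊓ y) = meas (t.eval w' ⊓ y') := by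
      rintro c c' s rfl rfl hc
      refine ih _ _ (fun j hj => ?_) fun t => ?_
      · rcases eq_or_ne j i with rfl | hji
        · rcases hc with ⟨h1, h2⟩ | ⟨h1, h2⟩
          · right; rw [h1, h2]; exact ⟨inf_le_right, inf_le_right⟩
          · left; rw [h1, h2]; constructor <;> rw [inf_assoc, compl_inf_self, inf_bot_eq]
        · rcases h j (by simp [hji, hj]) with h | h
          · left
            rw [inf_right_comm, h.1, inf_right_comm, h.2]
            exact ⟨bot_inf_eq _, bot_inf_eq _⟩
          · exact Or.inr ⟨inf_le_left.trans h.1, inf_le_left.trans h.2⟩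
      · rw [inf_assoc, inf_assoc]
        exact agree (.inter s t)
    obtain ⟨y₁, h₁, e₁⟩ := side _ _ (.var i) rfl rfl (Or.inl ⟨rfl, rfl⟩)
    obtain ⟨y₂, h₂, e₂⟩ := side _ _ (.compl (.var i)) rfl rfl (Or.inr ⟨rfl, rfl⟩)
    change y₁ ≤ b' ⊓ w' i at h₁
    change y₂ ≤ b' ⊓ (w' i)ᶜ at h₂
    refine ⟨y₁ ⊔ y₂, sup_le (h₁.trans inf_le_left) (h₂.trans inf_le_left), fun t => ?_⟩
    have d : Disjoint (t.eval w' ⊓ y₁) (t.eval w' ⊓ y₂) :=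
      (disjoint_compl_right (a := w' i)).mono (inf_le_right.trans (h₁.trans inf_le_right))
        (inf_le_right.trans (h₂.trans inf_le_right))
    rw [inf_sup_left, meas_sup d, ← e₁, ← e₂, ← meas_inf_add_inf_compl _ (w i)]
    change meas (b ⊓ t.eval w ⊓ y ⊓ w i) + meas (b ⊓ t.eval w ⊓ y ⊓ (w i)ᶜ) =
      meas (b ⊓ w i ⊓ t.eval w ⊓ y) + meas (b ⊓ (w i)ᶜ ⊓ t.eval w ⊓ y)
    congr 2 <;> ac_rfl

end Matching

/-- Substitution of terms for variables. -/
def Term.bind {α β : Type*} (σ : α → Term β) : Term α → Term β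
  | .var a => σ a
  | .zero => .zero
  | .one => .one
  | .compl t => .compl (t.bind σ)
  | .inter s t => .inter (s.bind σ) (t.bind σ)
  | .union s t => .union (s.bind σ) (t.bind σ)

lemma Term.eval_bind {α β : Type*} {M : Type*} [MetricStructure M] (σ : α → Term β) (v : β → M)
    (t : Term α) : (t.bind σ).eval v = t.eval fun a => (σ a).eval v := by
  induction t <;> simp_all [Term.bind, Term.eval]

/-- Two assignments agree on a cell if all terms have the same values there. -/
lemma Term.inf_eval_congr {α : Type u} {M : Type*} [MetricStructure M] [IsAPA M] {v w : α → M}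
    {b : M} (h : ∀ a, b ⊓ v a = b ⊓ w a) (t : Term α) : b ⊓ t.eval v = b ⊓ t.eval w := by
  induction t with
  | var a => exact h a
  | zero => rfl
  | one => rfl
  | compl t ih =>
    change b ⊓ (t.eval v)ᶜ = b ⊓ (t.eval w)ᶜ
    rw [← sdiff_eq, ← sdiff_eq, ← sdiff_inf_self_left, ih, sdiff_inf_self_left]
  | inter s t ihs iht =>
    change b ⊓ (s.eval v ⊓ t.eval v) = b ⊓ (s.eval w ⊓ t.eval w)
    rw [inf_inf_distrib_left, ihs, iht, ← inf_inf_distrib_left]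
  | union s t ihs iht =>
    change b ⊓ (s.eval v ⊔ t.eval v) = b ⊓ (s.eval w ⊔ t.eval w)
    rw [inf_sup_left, ihs, iht, ← inf_sup_left]

/-- Replace the last variable by the closed term `c`. -/
def lastSubst {α : Type u} {n : ℕ} (c : Term (α ⊕ Fin n)) : α ⊕ Fin (n + 1) → Term (α ⊕ Fin n) :=
  Sum.elim (fun a => .var (.inl a)) (Fin.lastCases c fun i => .var (.inr i))

section Agree

variable {M N : Type*} [MetricStructure M] [MetricStructure N]

/-- Two assignments have the same quantifier-free type. -/
def Agree {ι : Type u} (w : ι → M) (w' : ι → N) : Prop :=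
  ∀ t : Term ι, meas (t.eval w) = meas (t.eval w')

lemma Agree.symm {ι : Type u} {w : ι → M} {w' : ι → N} (h : Agree w w') : Agree w' w :=
  fun t => (h t).symm

variable [IsAPA M] [IsAPA N]

/-- Inside `y` the last variable acts as 1, and inside `yᶜ` as 0. Writing the second part as a
difference leaves only meets with `y`, so a quantifier-free type is extended by specifying these
measures. -/
lemma meas_eval_snoc {α : Type u} {n : ℕ} (v : α → M) (x : Fin n → M) (y : M)
    (t : Term (α ⊕ Fin (n + 1))) :
    meas (t.eval (Sum.elim v (Fin.snoc x y : Fin (n + 1) → M))) =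
      meas ((t.bind (lastSubst .one)).eval (Sum.elim v x) ⊓ y) +
      (meas ((t.bind (lastSubst .zero)).eval (Sum.elim v x)) -
        meas ((t.bind (lastSubst .zero)).eval (Sum.elim v x) ⊓ y)) := by
  rw [← meas_inf_add_inf_compl _ y, ← meas_inf_add_inf_compl
    ((t.bind (lastSubst .zero)).eval (Sum.elim v x)) y, add_sub_cancel_left]
  simp only [inf_comm _ y, inf_comm _ yᶜ, Term.eval_bind]
  congr 2
  · refine Term.inf_eval_congr (fun a => ?_) t
    rcases a with a | i
    · rfl
    · refine Fin.lastCases ?_ (fun i => ?_) i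
      · simp [lastSubst, Term.eval]
        exact le_top
      · simp [lastSubst, Term.eval]
  · refine Term.inf_eval_congr (fun a => ?_) t
    rcases a with a | i
    · rfl
    · refine Fin.lastCases ?_ (fun i => ?_) i
      · simp [lastSubst, Term.eval]
        exact (inf_bot_eq yᶜ).symm
      · simp [lastSubst, Term.eval]

lemma Agree.snoc {α : Type u} {n : ℕ} {v : α → M} {v' : α → N} {x : Fin n → M} {x' : Fin n → N}
    (h : Agree (Sum.elim v x) (Sum.elim v' x')) {y : M} {y' : N}
    (hy : ∀ t : Term (α ⊕ Fin n),
      meas (t.eval (Sum.elim v x) ⊓ y) = meas (t.eval (Sum.elim v' x') ⊓ y')) :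
    Agree (Sum.elim v (Fin.snoc x y : Fin (n + 1) → M))
      (Sum.elim v' (Fin.snoc x' y' : Fin (n + 1) → N)) := fun t => by
  rw [meas_eval_snoc, meas_eval_snoc, hy, hy, h]

/-- The back-and-forth step. Parameters equal to `⊥` outside `F` are trivial on every cell, which
gives `exists_matching` its finiteness condition. -/
lemma Agree.exists_snoc {α : Type u} {n : ℕ} {v : α → M} {v' : α → N}
    {x : Fin n → M} {x' : Fin n → N} (h : Agree (Sum.elim v x) (Sum.elim v' x'))
    {F : Finset α} (hv : ∀ a ∉ F, v a = ⊥) (hv' : ∀ a ∉ F, v' a = ⊥) (y : M) :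
    ∃ y' : N, Agree (Sum.elim v (Fin.snoc x y : Fin (n + 1) → M))
      (Sum.elim v' (Fin.snoc x' y' : Fin (n + 1) → N)) := by
  obtain ⟨y', -, hy'⟩ := exists_matching (F.disjSum Finset.univ) (Sum.elim v x) (Sum.elim v' x') y
    ⊤ ⊤ (fun i hi => by
      rcases i with a | i
      · left
        have ha : a ∉ F := fun ha => hi (Finset.inl_mem_disjSum.2 ha)
        rw [Sum.elim_inl, Sum.elim_inl, hv a ha, hv' a ha]
        exact ⟨inf_bot_eq _, inf_bot_eq _⟩
      · exact absurd (Finset.inr_mem_disjSum.2 (Finset.mem_univ i)) hi)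
    (fun t => by rw [top_inf_eq, top_inf_eq]; exact h t)
  exact ⟨y', h.snoc fun t => by rw [← hy', top_inf_eq]⟩

lemma Agree.dist_eq {ι : Type u} {w : ι → M} {w' : ι → N} (h : Agree w w') (s t : Term ι) :
    dist (s.eval w) (t.eval w) = dist (s.eval w') (t.eval w') := by
  rw [dist_eq_meas, dist_eq_meas]
  exact h (symmDiffTerm s t)

/-- At a quantifier every witness on one side has an exact counterpart on the other, so suprema and
infima coincide without approximation. -/
lemma Agree.eval_eq_of_finite {α : Type u} {F : Finset α} {v : α → M} {v' : α → N}
    (hv : ∀ a ∉ F, v a = ⊥) (hv' : ∀ a ∉ F, v' a = ⊥) {n : ℕ} (φ : Formula α n) :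
    ∀ {x : Fin n → M} {x' : Fin n → N}, Agree (Sum.elim v x) (Sum.elim v' x') →
      φ.eval v x = φ.eval v' x' := by
  induction φ with
  | measure t => exact fun h => Subtype.ext (h t)
  | dist s t => exact fun h => Subtype.ext (h.dist_eq s t)
  | conn c φ ih => exact fun h => congrArg c (funext fun i => ih i h)
  | sup φ ih =>
    intro x x' h
    refine le_antisymm (iSup_le fun y => ?_) (iSup_le fun y => ?_)
    · obtain ⟨y', hy⟩ := h.exists_snoc hv hv' y
      exact (ih hy).trans_le (le_iSup (fun y => φ.eval v' (Fin.snoc x' y)) y')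
    · obtain ⟨y', hy⟩ := h.symm.exists_snoc hv' hv y
      exact (ih hy.symm).symm.trans_le (le_iSup (fun y => φ.eval v (Fin.snoc x y)) y')
  | inf φ ih =>
    intro x x' h
    refine le_antisymm (le_iInf fun y => ?_) (le_iInf fun y => ?_)
    · obtain ⟨y', hy⟩ := h.symm.exists_snoc hv' hv y
      exact (iInf_le (fun y => φ.eval v (Fin.snoc x y)) y').trans (ih hy.symm).le
    · obtain ⟨y', hy⟩ := h.exists_snoc hv hv' y
      exact (iInf_le (fun y => φ.eval v' (Fin.snoc x' y)) y').trans (ih hy).ge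

end Agree

lemma Term.exists_finset {α : Type u} {n : ℕ} (t : Term (α ⊕ Fin n)) :
    ∃ F : Finset α, ∀ (M : Type*) [MetricStructure M] (v w : α → M) (x : Fin n → M),
      (∀ a ∈ F, v a = w a) → t.eval (Sum.elim v x) = t.eval (Sum.elim w x) := by
  classical
  induction t with
  | var i =>
    rcases i with a | i
    · exact ⟨{a}, fun M _ v w x h => h a (Finset.mem_singleton_self a)⟩
    · exact ⟨∅, fun M _ v w x h => rfl⟩
  | zero => exact ⟨∅, fun M _ v w x h => rfl⟩
  | one => exact ⟨∅, fun M _ v w x h => rfl⟩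
  | compl t ih =>
    obtain ⟨F, hF⟩ := ih
    exact ⟨F, fun M _ v w x h => congrArg MetricStructure.compl (hF M v w x h)⟩
  | inter s t ihs iht =>
    obtain ⟨F, hF⟩ := ihs
    obtain ⟨G, hG⟩ := iht
    exact ⟨F ∪ G, fun M _ v w x h => congrArg₂ MetricStructure.inter
      (hF M v w x fun a ha => h a (Finset.mem_union_left _ ha))
      (hG M v w x fun a ha => h a (Finset.mem_union_right _ ha))⟩
  | union s t ihs iht =>
    obtain ⟨F, hF⟩ := ihs
    obtain ⟨G, hG⟩ := iht
    exact ⟨F ∪ G, fun M _ v w x h => congrArg₂ MetricStructure.union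
      (hF M v w x fun a ha => h a (Finset.mem_union_left _ ha))
      (hG M v w x fun a ha => h a (Finset.mem_union_right _ ha))⟩

/-- The value of a formula depends on finitely many parameters. -/
lemma Formula.exists_finset {α : Type u} {n : ℕ} (φ : Formula α n) :
    ∃ F : Finset α, ∀ (M : Type*) [MetricStructure M] (v w : α → M) (x : Fin n → M),
      (∀ a ∈ F, v a = w a) → φ.eval v x = φ.eval w x := by
  classical
  induction φ with
  | measure t =>
    obtain ⟨F, hF⟩ := t.exists_finset
    exact ⟨F, fun M _ v w x h => congrArg MetricStructure.measure (hF M v w x h)⟩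
  | dist s t =>
    obtain ⟨F, hF⟩ := s.exists_finset
    obtain ⟨G, hG⟩ := t.exists_finset
    exact ⟨F ∪ G, fun M _ v w x h => Subtype.ext (congrArg₂ Dist.dist
      (hF M v w x fun a ha => h a (Finset.mem_union_left _ ha))
      (hG M v w x fun a ha => h a (Finset.mem_union_right _ ha)))⟩
  | conn c φ ih =>
    choose F hF using ih
    exact ⟨Finset.univ.biUnion F, fun M _ v w x h => congrArg c (funext fun i =>
      hF i M v w x fun a ha => h a (Finset.mem_biUnion.2 ⟨i, Finset.mem_univ i, ha⟩))⟩
  | sup φ ih =>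
    obtain ⟨F, hF⟩ := ih
    exact ⟨F, fun M _ v w x h => iSup_congr fun y => hF M v w _ h⟩
  | inf φ ih =>
    obtain ⟨F, hF⟩ := ih
    exact ⟨F, fun M _ v w x h => iInf_congr fun y => hF M v w _ h⟩

/-- Quantifier elimination: the quantifier-free type determines the values of all formulas. -/
theorem Agree.eval_eq {M N : Type u} [MetricStructure M] [MetricStructure N] [IsAPA M] [IsAPA N]
    {α : Type u} {v : α → M} {v' : α → N} {n : ℕ} {x : Fin n → M} {x' : Fin n → N}
    (h : Agree (Sum.elim v x) (Sum.elim v' x')) (φ : Formula α n) :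
    φ.eval v x = φ.eval v' x' := by
  classical
  obtain ⟨F, hF⟩ := φ.exists_finset
  -- Resetting the parameters that `φ` does not see to `⊥` reduces to the finite case; substituting
  -- `.zero` for them in terms preserves agreement.
  rw [hF M v (fun a => if a ∈ F then v a else ⊥) x fun a ha => by simp [ha],
    hF N v' (fun a => if a ∈ F then v' a else ⊥) x' fun a ha => by simp [ha]]
  refine Agree.eval_eq_of_finite (F := F) (fun a ha => if_neg ha) (fun a ha => if_neg ha) φ ?_
  intro t
  let σ : α ⊕ Fin n → Term (α ⊕ Fin n) :=
    Sum.elim (fun a => if a ∈ F then .var (.inl a) else .zero) fun i => .var (.inr i)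
  have key := h (t.bind σ)
  rw [Term.eval_bind, Term.eval_bind] at key
  have h1 : ∀ (K : Type u) [MetricStructure K] [IsAPA K] (w : α → K) (z : Fin n → K),
      (fun i => (σ i).eval (Sum.elim w z)) =
        Sum.elim (fun a => if a ∈ F then w a else ⊥) z := by
    intro K _ _ w z
    funext i
    rcases i with a | i
    · by_cases ha : a ∈ F
      · simp [σ, ha, Term.eval]
      · simp [σ, ha, Term.eval]; rfl
    · simp [σ, Term.eval]
  rwa [h1, h1] at key

end ProbAlg

/-! ### Finitely additive measures as measures on the Cantor space. -/

namespace ProbAlg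

open MeasureTheory
open scoped ENNReal

/-- The value of a term in a Boolean algebra. -/
def Term.bev {α B : Type*} [BooleanAlgebra B] (v : α → B) : Term α → B
  | .var a => v a
  | .zero => ⊥
  | .one => ⊤
  | .compl t => (t.bev v)ᶜ
  | .inter s t => s.bev v ⊓ t.bev v
  | .union s t => s.bev v ⊔ t.bev v

lemma Term.eval_eq_bev {α : Type u} {M : Type*} [MetricStructure M] [IsAPA M] (v : α → M)
    (t : Term α) : t.eval v = t.bev v := by
  induction t with
  | var a => rfl
  | zero => rfl
  | one => rfl
  | compl t ih => exact congrArg MetricStructure.compl ih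
  | inter s t ihs iht => exact congrArg₂ MetricStructure.inter ihs iht
  | union s t ihs iht => exact congrArg₂ MetricStructure.union ihs iht

/-- The clopen subset of the Cantor space on which a term is true. -/
def cyl {ι : Type*} (t : Term ι) : Set (ι → Bool) := t.bev fun i => {s | s i = true}

section Cylinders

variable {ι : Type*}

lemma isClopen_cyl (t : Term ι) : IsClopen (cyl t) := by
  induction t with
  | var i => exact (isClopen_discrete {true}).preimage (continuous_apply i)
  | zero => exact isClopen_empty
  | one => exact isClopen_univ
  | compl t ih => exact ih.compl
  | inter s t ihs iht => exact ihs.inter iht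
  | union s t ihs iht => exact ihs.union iht

lemma measurableSet_cyl (t : Term ι) : MeasurableSet (cyl t) := by
  induction t with
  | var i => exact measurableSet_eq_fun (measurable_pi_apply i) measurable_const
  | zero => exact MeasurableSet.empty
  | one => exact MeasurableSet.univ
  | compl t ih => exact ih.compl
  | inter s t ihs iht => exact ihs.inter iht
  | union s t ihs iht => exact ihs.union iht

lemma isSetRing_range_cyl : IsSetRing (Set.range (cyl (ι := ι))) where
  empty_mem := ⟨.zero, rfl⟩
  union_mem := by
    rintro _ _ ⟨s, rfl⟩ ⟨t, rfl⟩
    exact ⟨.union s t, rfl⟩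
  sdiff_mem := by
    rintro _ _ ⟨s, rfl⟩ ⟨t, rfl⟩
    exact ⟨.inter s (.compl t), rfl⟩

lemma generateFrom_range_cyl :
    (MeasurableSpace.pi : MeasurableSpace (ι → Bool)) =
      MeasurableSpace.generateFrom (Set.range (cyl (ι := ι))) := by
  apply le_antisymm
  · refine iSup_le fun i => ?_
    rw [← measurable_iff_comap_le]
    refine @measurable_to_bool _ (MeasurableSpace.generateFrom _) _ ?_
    exact MeasurableSpace.measurableSet_generateFrom ⟨.var i, rfl⟩
  · refine MeasurableSpace.generateFrom_le ?_
    rintro _ ⟨t, rfl⟩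
    exact measurableSet_cyl t

variable {A : Type*} [BooleanAlgebra A]

/-- A term which is identically false on the Cantor space vanishes in every Boolean algebra. -/
lemma bev_eq_bot_of_cyl_eq_empty (e : ι → A) {t : Term ι} (h : cyl t = ∅) : t.bev e = ⊥ := by
  classical
  by_contra hne
  obtain ⟨J, hJ, -, hd⟩ := DistribLattice.prime_ideal_of_disjoint_filter_ideal
    (F := Order.PFilter.principal (t.bev e)) (I := Order.Ideal.principal ⊥) (by
      rw [Set.disjoint_left]
      rintro x hx hx'
      have h1 : t.bev e ≤ x := hx
      have h2 : x ≤ ⊥ := hx'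
      exact hne (le_bot_iff.1 (h1.trans h2)))
  -- A prime ideal avoiding the value of the term defines a point of the Cantor space: the
  -- complement of `J` is an ultrafilter, so truth at the point means value outside `J`.
  have key : ∀ t : Term ι, (fun i => decide (e i ∉ J)) ∈ cyl t ↔ t.bev e ∉ J := by
    intro t
    induction t with
    | var i => exact decide_eq_true_iff
    | zero => exact iff_of_false (fun h => h) fun h => h J.bot_mem
    | one => exact iff_of_true trivial hJ.toIsProper.top_notMem
    | compl t ih =>
      refine (not_congr ih).trans (not_not.trans ⟨fun h h' => ?_, fun h' => ?_⟩)
      · exact hJ.toIsProper.top_notMem (sup_compl_eq_top (x := t.bev e) ▸ J.sup_mem h h')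
      · exact (hJ.mem_or_compl_mem).resolve_right h'
    | inter s t ihs iht =>
      refine (and_congr ihs iht).trans ⟨fun h h' => ?_, fun h => ?_⟩
      · exact (hJ.mem_or_mem h').elim h.1 h.2
      · exact ⟨fun h' => h (J.lower inf_le_left h'), fun h' => h (J.lower inf_le_right h')⟩
    | union s t ihs iht =>
      refine (or_congr ihs iht).trans ⟨fun h h' => ?_, fun h => ?_⟩
      · exact h.elim (fun h => h (J.lower le_sup_left h')) fun h => h (J.lower le_sup_right h')
      · by_contra hc
        rw [not_or, not_not, not_not] at hc
        exact h (J.sup_mem hc.1 hc.2)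
  have h1 := (key t).2 (Set.disjoint_left.1 hd (show t.bev e ≤ t.bev e from le_rfl))
  rw [h] at h1
  exact h1

lemma disjoint_bev (e : ι → A) {s t : Term ι} (h : Disjoint (cyl s) (cyl t)) :
    Disjoint (s.bev e) (t.bev e) :=
  disjoint_iff.2 (bev_eq_bot_of_cyl_eq_empty e (t := .inter s t) (disjoint_iff.1 h))

/-- Makes a set function defined on cylinders through representing terms independent of the term. -/
lemma bev_eq_of_cyl_eq (e : ι → A) {s t : Term ι} (h : cyl s = cyl t) : s.bev e = t.bev e := by
  apply le_antisymm
  · refine disjoint_compl_right_iff.1 (disjoint_bev e (t := .compl t) ?_)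
    rw [h]; exact disjoint_compl_right (a := cyl t)
  · refine disjoint_compl_right_iff.1 (disjoint_bev e (t := .compl s) ?_)
    rw [← h]; exact disjoint_compl_right (a := cyl s)

/-- A content on a compact space which is supported by clopen sets is sigma-subadditive. -/
lemma isSigmaSubadditive_of_isClopen {X : Type*} [TopologicalSpace X] [CompactSpace X]
    {C : Set (Set X)} (hC : IsSetRing C) (hcl : ∀ s ∈ C, IsClopen s) (m : AddContent ℝ≥0∞ C) :
    m.IsSigmaSubadditive := by
  intro f hf hU
  -- The union is itself clopen, hence compact, so finitely many of the open `f i` already cover it.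
  obtain ⟨F, hF⟩ := (hcl _ hU).isClosed.isCompact.elim_finite_subcover f
    (fun i => (hcl _ (hf i)).isOpen) le_rfl
  have hF' : ⋃ i, f i = ⋃ i ∈ F, f i := hF.antisymm (Set.iUnion₂_subset_iUnion _ _)
  rw [hF']
  exact (addContent_biUnion_le hC fun i _ => hf i).trans (ENNReal.sum_le_tsum F)

/-- Every finitely additive measure on a Boolean algebra with distinguished elements `e i` is
represented by a measure on the Cantor space. -/
theorem exists_measure_cyl (e : ι → A) (m : A → ℝ≥0∞) (h0 : m ⊥ = 0)
    (hm : ∀ a b, Disjoint a b → m (a ⊔ b) = m a + m b) :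
    ∃ ν : Measure (ι → Bool), ∀ t, ν (cyl t) = m (t.bev e) := by
  classical
  let f : Set (ι → Bool) → ℝ≥0∞ := fun s => if h : ∃ t, cyl t = s then m (h.choose.bev e) else 0
  have hf : ∀ t, f (cyl t) = m (t.bev e) := fun t => by
    have h : ∃ t', cyl t' = cyl t := ⟨t, rfl⟩
    simp only [f, dif_pos h]
    rw [bev_eq_of_cyl_eq e h.choose_spec]
  let c : AddContent ℝ≥0∞ (Set.range (cyl (ι := ι))) :=
    isSetRing_range_cyl.addContent_of_union f ((hf .zero).trans h0) (by
      rintro _ _ ⟨s, rfl⟩ ⟨t, rfl⟩ hd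
      rw [hf, hf, ← hm _ _ (disjoint_bev e hd)]
      exact hf (.union s t))
  have hc := isSigmaSubadditive_of_isClopen isSetRing_range_cyl
    (by rintro _ ⟨t, rfl⟩; exact isClopen_cyl t) c
  refine ⟨c.measure isSetRing_range_cyl.isSetSemiring generateFrom_range_cyl.le hc, fun t => ?_⟩
  rw [c.measure_eq isSetRing_range_cyl.isSetSemiring generateFrom_range_cyl hc ⟨t, rfl⟩]
  exact hf t

end Cylinders

end ProbAlg

/-! ### Measure algebras as complete separable metric structures. -/

namespace ProbAlg

open MeasureTheory Filter Topology
open scoped ENNReal symmDiff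

section MeasuredSets

variable {Ω : Type u} [MeasurableSpace Ω] {μ : Measure Ω}

lemma tsum_half_pow_add (n : ℕ) : ∑' k, (1 / 2 : ℝ≥0∞) ^ (n + k) = (1 / 2) ^ n * 2 := by
  simp_rw [pow_add, ENNReal.tsum_mul_left, ENNReal.tsum_geometric, one_div]
  rw [ENNReal.one_sub_inv_two, inv_inv]

/-- A fast Cauchy sequence converges to its limit superior `L`: a point on which `v n` and `L`
differ must change membership between two consecutive later sets, and those differences have
summable measure. -/
instance : CompleteSpace (MeasuredSets μ) := by
  refine EMetric.complete_of_convergent_controlled_sequences (fun n => (1 / 2 : ℝ≥0∞) ^ n)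
    (fun n => ENNReal.pow_pos (by simp) n) fun v hv => ?_
  let L : Set Ω := ⋂ n, ⋃ k, (v (n + k)).1
  have hL : MeasurableSet L :=
    MeasurableSet.iInter fun n => MeasurableSet.iUnion fun k => (v (n + k)).2
  have chain : ∀ (n k : ℕ) (x : Ω), ((x ∈ (v n).1 ∧ x ∉ (v (n + k)).1) ∨
      (x ∉ (v n).1 ∧ x ∈ (v (n + k)).1)) → ∃ j, x ∈ (v (n + j)).1 ∆ (v (n + j + 1)).1 := by
    intro n k x
    induction k with
    | zero => rintro (h | h) <;> exact absurd h.1 (by simp_all)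
    | succ k ih =>
      intro h
      by_cases h' : (x ∈ (v n).1 ∧ x ∉ (v (n + k)).1) ∨ (x ∉ (v n).1 ∧ x ∈ (v (n + k)).1)
      · exact ih h'
      · refine ⟨k, ?_⟩
        rw [Set.mem_symmDiff]
        rw [← add_assoc] at h
        tauto
  have hsub : ∀ n, (v n).1 ∆ L ⊆ ⋃ k, (v (n + k)).1 ∆ (v (n + k + 1)).1 := by
    intro n x hx
    rw [Set.mem_iUnion]
    rcases (Set.mem_symmDiff).1 hx with ⟨h1, h2⟩ | ⟨h1, h2⟩
    · simp only [L, Set.mem_iInter, Set.mem_iUnion, not_forall, not_exists] at h2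
      obtain ⟨m, hm⟩ := h2
      exact chain n m x (Or.inl ⟨h1, by rw [add_comm]; exact hm n⟩)
    · simp only [L, Set.mem_iInter, Set.mem_iUnion] at h1
      obtain ⟨k, hk⟩ := h1 n
      exact chain n k x (Or.inr ⟨h2, hk⟩)
  let l : MeasuredSets μ := ⟨L, hL⟩
  refine ⟨l, tendsto_iff_edist_tendsto_0.2 ?_⟩
  have hle : ∀ n, edist (v n) l ≤ (1 / 2 : ℝ≥0∞) ^ n * 2 := fun n => by
    rw [← tsum_half_pow_add]
    refine (measure_mono (hsub n)).trans ((measure_iUnion_le _).trans (ENNReal.tsum_le_tsum ?_))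
    exact fun k => (hv (n + k) (n + k) (n + k + 1) le_rfl (Nat.le_succ _)).le
  refine tendsto_of_tendsto_of_tendsto_of_le_of_le tendsto_const_nhds ?_ (fun _ => zero_le) hle
  have := ENNReal.Tendsto.mul_const (b := 2)
    (ENNReal.tendsto_pow_atTop_nhds_zero_of_lt_one (r := 1 / 2) (by simp))
    (Or.inr ENNReal.ofNat_ne_top)
  simpa using this

/-- The set algebra generated by a countable generating family is countable and approximates every
measurable set. -/
instance [MeasurableSpace.CountablyGenerated Ω] [IsFiniteMeasure μ] :
    TopologicalSpace.SeparableSpace (MeasuredSets μ) := by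
  let C := generateSetAlgebra (MeasurableSpace.countableGeneratingSet Ω)
  have hC : C.Countable :=
    countable_generateSetAlgebra (MeasurableSpace.countable_countableGeneratingSet)
  have hA : IsSetAlgebra C := isSetAlgebra_generateSetAlgebra
  refine ⟨SetLike.coe ⁻¹' C, hC.preimage SetLike.coe_injective,
    dense_of_generateFrom_isSetRing hA.isSetRing
      ⟨{Set.univ}, Set.countable_singleton _, by simpa using hA.univ_mem, by simp⟩ ?_⟩
  rw [generateFrom_generateSetAlgebra_eq, MeasurableSpace.generateFrom_countableGeneratingSet]

end MeasuredSets

/-- The measure algebra of a measure space. -/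
abbrev MeasAlg {Ω : Type u} [MeasurableSpace Ω] (μ : Measure Ω) : Type u :=
  SeparationQuotient (MeasuredSets μ)

instance {Ω : Type u} [MeasurableSpace Ω] [MeasurableSpace.CountablyGenerated Ω] (μ : Measure Ω)
    [IsFiniteMeasure μ] : TopologicalSpace.SeparableSpace (MeasAlg μ) :=
  SeparationQuotient.surjective_mk.denseRange.separableSpace SeparationQuotient.continuous_mk

namespace MeasAlg

variable {Ω : Type u} [MeasurableSpace Ω] {μ : Measure Ω}

variable (μ) in
/-- The class of a measurable set. -/
noncomputable def mk (s : Set Ω) (hs : MeasurableSet s) : MeasAlg μ := SeparationQuotient.mk ⟨s, hs⟩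

lemma mk_surjective (a : MeasAlg μ) : ∃ s hs, mk μ s hs = a := by
  obtain ⟨⟨s, hs⟩, rfl⟩ := SeparationQuotient.surjective_mk a
  exact ⟨s, hs, rfl⟩

lemma mk_congr {s t : Set Ω} (hs : MeasurableSet s) (ht : MeasurableSet t) (h : s = t) :
    mk μ s hs = mk μ t ht := by
  subst h; rfl

lemma real_compl_symmDiff (s s' : Set Ω) : μ.real (sᶜ ∆ s'ᶜ) = μ.real (s ∆ s') := by
  rw [compl_symmDiff_compl]

variable [IsProbabilityMeasure μ]

lemma dist_mk {s t : Set Ω} (hs : MeasurableSet s) (ht : MeasurableSet t) :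
    dist (mk μ s hs) (mk μ t ht) = μ.real (s ∆ t) := rfl

lemma real_inter_symmDiff_le (s s' t t' : Set Ω) :
    μ.real ((s ∩ t) ∆ (s' ∩ t')) ≤ μ.real (s ∆ s') + μ.real (t ∆ t') := by
  refine (measureReal_mono ?_).trans (measureReal_union_le _ _)
  intro x
  simp only [Set.mem_symmDiff, Set.mem_inter_iff, Set.mem_union]
  tauto

lemma real_union_symmDiff_le (s s' t t' : Set Ω) :
    μ.real ((s ∪ t) ∆ (s' ∪ t')) ≤ μ.real (s ∆ s') + μ.real (t ∆ t') := by
  refine (measureReal_mono ?_).trans (measureReal_union_le _ _)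
  intro x
  simp only [Set.mem_symmDiff, Set.mem_union]
  tauto

/-- Complements in the measure algebra. -/
noncomputable def compl : MeasAlg μ → MeasAlg μ :=
  SeparationQuotient.lift (fun s => mk μ s.1ᶜ s.2.compl) fun s t h => by
    rw [Metric.inseparable_iff] at h
    rw [← dist_eq_zero, dist_mk, real_compl_symmDiff]
    exact h

/-- Intersections in the measure algebra. -/
noncomputable def inter : MeasAlg μ → MeasAlg μ → MeasAlg μ :=
  SeparationQuotient.lift₂ (fun s t => mk μ (s.1 ∩ t.1) (s.2.inter t.2)) fun s t s' t' h h' => by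
    rw [Metric.inseparable_iff] at h h'
    rw [← dist_eq_zero, dist_mk]
    exact le_antisymm ((real_inter_symmDiff_le _ _ _ _).trans_eq
      (show dist s s' + dist t t' = 0 by rw [h, h', add_zero])) measureReal_nonneg

/-- Unions in the measure algebra. -/
noncomputable def union : MeasAlg μ → MeasAlg μ → MeasAlg μ :=
  SeparationQuotient.lift₂ (fun s t => mk μ (s.1 ∪ t.1) (s.2.union t.2)) fun s t s' t' h h' => by
    rw [Metric.inseparable_iff] at h h'
    rw [← dist_eq_zero, dist_mk]
    exact le_antisymm ((real_union_symmDiff_le _ _ _ _).trans_eq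
      (show dist s s' + dist t t' = 0 by rw [h, h', add_zero])) measureReal_nonneg

lemma abs_real_sub_le {s t : Set Ω} (hs : MeasurableSet s) (ht : MeasurableSet t) :
    |μ.real s - μ.real t| ≤ μ.real (s ∆ t) := by
  rw [abs_le]
  have h1 : μ.real s - μ.real t ≤ μ.real (s ∆ t) :=
    MeasuredSets.real_sub_real_le_dist (μ := μ) ⟨s, hs⟩ ⟨t, ht⟩
  have h2 : μ.real t - μ.real s ≤ μ.real (t ∆ s) :=
    MeasuredSets.real_sub_real_le_dist (μ := μ) ⟨t, ht⟩ ⟨s, hs⟩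
  rw [symmDiff_comm] at h2
  constructor <;> linarith

/-- The measure of a class. -/
noncomputable def measure : MeasAlg μ → unitInterval :=
  SeparationQuotient.lift (fun s => ⟨μ.real s.1, measureReal_nonneg, measureReal_le_one⟩)
    fun s t h => by
      rw [Metric.inseparable_iff] at h
      exact Subtype.ext (sub_eq_zero.1 (abs_eq_zero.1
        (le_antisymm ((abs_real_sub_le s.2 t.2).trans_eq h) (abs_nonneg _))))

noncomputable instance : MetricStructure (MeasAlg μ) where
  zero := mk μ ∅ MeasurableSet.empty
  one := mk μ Set.univ MeasurableSet.univ
  compl := compl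
  inter := inter
  union := union
  measure := measure
  dist_le_one x y := by
    obtain ⟨s, hs, rfl⟩ := mk_surjective x
    obtain ⟨t, ht, rfl⟩ := mk_surjective y
    exact measureReal_le_one
  compl_modulus ε hε x y h := by
    obtain ⟨s, hs, rfl⟩ := mk_surjective x
    obtain ⟨t, ht, rfl⟩ := mk_surjective y
    exact (real_compl_symmDiff s t).trans_le h.le
  inter_modulus ε hε x x' y y' h h' := by
    obtain ⟨s, hs, rfl⟩ := mk_surjective x
    obtain ⟨t, ht, rfl⟩ := mk_surjective y
    obtain ⟨s', hs', rfl⟩ := mk_surjective x'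
    obtain ⟨t', ht', rfl⟩ := mk_surjective y'
    refine (real_inter_symmDiff_le s s' t t').trans ?_
    rw [dist_mk] at h h'
    linarith
  union_modulus ε hε x x' y y' h h' := by
    obtain ⟨s, hs, rfl⟩ := mk_surjective x
    obtain ⟨t, ht, rfl⟩ := mk_surjective y
    obtain ⟨s', hs', rfl⟩ := mk_surjective x'
    obtain ⟨t', ht', rfl⟩ := mk_surjective y'
    refine (real_union_symmDiff_le s s' t t').trans ?_
    rw [dist_mk] at h h'
    linarith
  measure_modulus ε hε x y h := by
    obtain ⟨s, hs, rfl⟩ := mk_surjective x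
    obtain ⟨t, ht, rfl⟩ := mk_surjective y
    exact (abs_real_sub_le hs ht).trans h.le

lemma isAPA (hμ : ∀ s : Set Ω, MeasurableSet s →
    ∃ t, MeasurableSet t ∧ μ.real (s ∩ t) = μ.real (s ∩ tᶜ)) : IsAPA (MeasAlg μ) where
  union_comm x y := by
    obtain ⟨s, hs, rfl⟩ := mk_surjective x
    obtain ⟨t, ht, rfl⟩ := mk_surjective y
    exact mk_congr _ _ (Set.union_comm s t)
  inter_comm x y := by
    obtain ⟨s, hs, rfl⟩ := mk_surjective x
    obtain ⟨t, ht, rfl⟩ := mk_surjective y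
    exact mk_congr _ _ (Set.inter_comm s t)
  union_assoc x y z := by
    obtain ⟨s, hs, rfl⟩ := mk_surjective x
    obtain ⟨t, ht, rfl⟩ := mk_surjective y
    obtain ⟨r, hr, rfl⟩ := mk_surjective z
    exact mk_congr _ _ (Set.union_assoc s t r)
  inter_assoc x y z := by
    obtain ⟨s, hs, rfl⟩ := mk_surjective x
    obtain ⟨t, ht, rfl⟩ := mk_surjective y
    obtain ⟨r, hr, rfl⟩ := mk_surjective z
    exact mk_congr _ _ (Set.inter_assoc s t r)
  union_inter_self x y := by
    obtain ⟨s, hs, rfl⟩ := mk_surjective x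
    obtain ⟨t, ht, rfl⟩ := mk_surjective y
    exact mk_congr _ _ (sup_inf_self (a := s) (b := t))
  inter_union_self x y := by
    obtain ⟨s, hs, rfl⟩ := mk_surjective x
    obtain ⟨t, ht, rfl⟩ := mk_surjective y
    exact mk_congr _ _ (inf_sup_self (a := s) (b := t))
  inter_union_distrib x y z := by
    obtain ⟨s, hs, rfl⟩ := mk_surjective x
    obtain ⟨t, ht, rfl⟩ := mk_surjective y
    obtain ⟨r, hr, rfl⟩ := mk_surjective z
    exact mk_congr _ _ (Set.inter_union_distrib_left s t r)
  union_inter_distrib x y z := by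
    obtain ⟨s, hs, rfl⟩ := mk_surjective x
    obtain ⟨t, ht, rfl⟩ := mk_surjective y
    obtain ⟨r, hr, rfl⟩ := mk_surjective z
    exact mk_congr _ _ (Set.union_inter_distrib_left s t r)
  union_compl x := by
    obtain ⟨s, hs, rfl⟩ := mk_surjective x
    exact mk_congr _ _ (Set.union_compl_self s)
  inter_compl x := by
    obtain ⟨s, hs, rfl⟩ := mk_surjective x
    exact mk_congr _ _ (Set.inter_compl_self s)
  measure_zero := measureReal_empty
  measure_one := probReal_univ
  modular x y := by
    obtain ⟨s, hs, rfl⟩ := mk_surjective x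
    obtain ⟨t, ht, rfl⟩ := mk_surjective y
    exact measureReal_union_add_inter ht
  dist_eq x y := by
    obtain ⟨s, hs, rfl⟩ := mk_surjective x
    obtain ⟨t, ht, rfl⟩ := mk_surjective y
    change μ.real (s ∆ t) = μ.real ((s ∩ tᶜ) ∪ (sᶜ ∩ t))
    rw [Set.symmDiff_def, Set.sdiff_eq, Set.sdiff_eq, Set.inter_comm t]
  atomless x ε hε := by
    obtain ⟨s, hs, rfl⟩ := mk_surjective x
    obtain ⟨t, ht, h⟩ := hμ s hs
    refine ⟨mk μ t ht, ?_⟩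
    change |μ.real (s ∩ t) - μ.real (s ∩ tᶜ)| < ε
    rwa [h, sub_self, abs_zero]

end MeasAlg

/-! ### Atomlessness from an interval factor. -/

/-- The product of a measure with the Lebesgue measure on `[0, 1]`. -/
noncomputable def prodUnit {X : Type u} [MeasurableSpace X] (ν : Measure X) : Measure (X × ℝ) :=
  ν.prod (volume.restrict (Set.Icc 0 1))

section ProdUnit

variable {X : Type u} [MeasurableSpace X] {ν : Measure X}

instance : IsProbabilityMeasure (volume.restrict (Set.Icc (0 : ℝ) 1)) :=
  ⟨by simp⟩

instance [IsProbabilityMeasure ν] : IsProbabilityMeasure (prodUnit ν) := by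
  unfold prodUnit; infer_instance

lemma prodUnit_real_snd [IsProbabilityMeasure ν] (s : Set ℝ) :
    (prodUnit ν).real (Prod.snd ⁻¹' s) = (volume.restrict (Set.Icc (0 : ℝ) 1)).real s := by
  rw [← Set.univ_prod, prodUnit, measureReal_prod_prod, probReal_univ, one_mul]

/-- The part of `s` up to height r has measure 1-Lipschitz in r, growing from 0 to that of `s`; by
the intermediate value theorem some horizontal cut halves `s`. -/
lemma prodUnit_halving [IsProbabilityMeasure ν] (s : Set (X × ℝ)) :
    ∃ t, MeasurableSet t ∧ (prodUnit ν).real (s ∩ t) = (prodUnit ν).real (s ∩ tᶜ) := by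
  let g : ℝ → ℝ := fun r => (prodUnit ν).real (s ∩ Prod.snd ⁻¹' Set.Iic r)
  have hg : LipschitzWith 1 g := by
    refine LipschitzWith.of_le_add fun r r' => ?_
    have h1 : s ∩ Prod.snd ⁻¹' Set.Iic r ⊆
        (s ∩ Prod.snd ⁻¹' Set.Iic r') ∪ Prod.snd ⁻¹' Set.Ioc r' r := by
      intro x hx
      rcases le_or_gt x.2 r' with h | h
      · exact Or.inl ⟨hx.1, h⟩
      · exact Or.inr ⟨h, hx.2⟩
    refine (measureReal_mono h1).trans ((measureReal_union_le _ _).trans ?_)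
    gcongr
    rw [prodUnit_real_snd]
    calc (volume.restrict (Set.Icc (0 : ℝ) 1)).real (Set.Ioc r' r)
        ≤ volume.real (Set.Ioc r' r) :=
          ENNReal.toReal_mono (by simp) (Measure.restrict_apply_le _ _)
      _ = max (r - r') 0 := by rw [Measure.real, Real.volume_Ioc, ENNReal.toReal_ofReal']
      _ ≤ dist r r' := max_le (le_abs_self _) dist_nonneg
  have h0 : g 0 = 0 := by
    refine le_antisymm ((measureReal_mono Set.inter_subset_right).trans ?_) measureReal_nonneg
    have : Set.Iic (0 : ℝ) ∩ Set.Icc 0 1 ⊆ {0} := fun x hx => le_antisymm hx.1 hx.2.1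
    rw [prodUnit_real_snd, measureReal_restrict_apply measurableSet_Iic]
    exact (measureReal_mono this (by simp)).trans (by simp [Measure.real])
  have h1 : g 1 = (prodUnit ν).real s := by
    have : (prodUnit ν).real (s ∩ (Prod.snd ⁻¹' Set.Iic 1)ᶜ) = 0 := by
      refine le_antisymm ((measureReal_mono Set.inter_subset_right).trans ?_) measureReal_nonneg
      rw [← Set.preimage_compl, prodUnit_real_snd,
        measureReal_restrict_apply measurableSet_Iic.compl]
      have : (Set.Iic (1 : ℝ))ᶜ ∩ Set.Icc 0 1 = ∅ := by
        ext x
        simp only [Set.mem_inter_iff, Set.mem_compl_iff, Set.mem_Iic, Set.mem_Icc,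
          Set.mem_empty_iff_false, iff_false]
        tauto
      rw [this, measureReal_empty]
    have h2 := measureReal_inter_add_sdiff (μ := prodUnit ν) (s := s)
      (measurable_snd measurableSet_Iic : MeasurableSet (Prod.snd ⁻¹' Set.Iic (1 : ℝ)))
    rw [Set.sdiff_eq, this, add_zero] at h2
    exact h2
  obtain ⟨r, -, hr⟩ := intermediate_value_Icc (zero_le_one (α := ℝ)) hg.continuous.continuousOn
    (show (prodUnit ν).real s / 2 ∈ Set.Icc (g 0) (g 1) by
      rw [h0, h1]; constructor <;> linarith [measureReal_nonneg (μ := prodUnit ν) (s := s)])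
  have hm : MeasurableSet (Prod.snd ⁻¹' Set.Iic r : Set (X × ℝ)) := measurable_snd measurableSet_Iic
  refine ⟨_, hm, ?_⟩
  have h2 := measureReal_inter_add_sdiff (μ := prodUnit ν) (s := s) hm
  rw [Set.sdiff_eq] at h2
  change g r + _ = _ at h2
  change g r = _
  linarith

instance [IsProbabilityMeasure ν] : IsAPA (MeasAlg (prodUnit ν)) := 
  MeasAlg.isAPA fun s _ => prodUnit_halving s

end ProdUnit

end ProbAlg

/-! ### Realizing all types in the Cantor model. -/

namespace ProbAlg

open MeasureTheory
open scoped ENNReal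

/-- Renaming of the parameters of a formula. -/
def Formula.map {α β : Type*} (g : α → β) : {n : ℕ} → Formula α n → Formula β n
  | _, .measure t => .measure (t.bind fun i => .var (Sum.map g id i))
  | _, .dist s t => .dist (s.bind fun i => .var (Sum.map g id i))
      (t.bind fun i => .var (Sum.map g id i))
  | _, .conn c φ => .conn c fun i => (φ i).map g
  | _, .sup φ => .sup (φ.map g)
  | _, .inf φ => .inf (φ.map g)

section Semantics

variable {M N : Type*} [MetricStructure M] [MetricStructure N]

lemma Term.eval_map {α β : Type*} (g : α → β) {n : ℕ} (v : β → M) (x : Fin n → M)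
    (t : Term (α ⊕ Fin n)) :
    (t.bind fun i => .var (Sum.map g id i)).eval (Sum.elim v x) =
      t.eval (Sum.elim (v ∘ g) x) := by
  rw [Term.eval_bind]
  congr 1
  funext i
  rcases i with a | i <;> rfl

lemma Formula.eval_map {α β : Type*} (g : α → β) (v : β → M) {n : ℕ} (φ : Formula α n) :
    ∀ x : Fin n → M, (φ.map g).eval v x = φ.eval (v ∘ g) x := by
  induction φ with
  | measure t => exact fun x => congrArg MetricStructure.measure (Term.eval_map g v x t)
  | dist s t =>
    exact fun x => Subtype.ext
      (congrArg₂ Dist.dist (Term.eval_map g v x s) (Term.eval_map g v x t))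
  | conn c φ ih => exact fun x => congrArg c (funext fun i => ih i x)
  | sup φ ih => exact fun x => iSup_congr fun y => ih _
  | inf φ ih => exact fun x => iInf_congr fun y => ih _

end Semantics

section ModelsOver

lemma Agree.elim0 {M N α : Type u} [MetricStructure M] [MetricStructure N] {v : α → M} {w : α → N}
    (h : Agree v w) :
    Agree (Sum.elim v Fin.elim0) (Sum.elim w Fin.elim0) := by
  intro t
  have h1 := h (t.bind (Sum.elim .var Fin.elim0))
  rw [Term.eval_bind, Term.eval_bind] at h1
  convert h1 using 3 with i i <;>
  · funext i
    rcases i with a | i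
    · rfl
    · exact i.elim0

/-- Combines `Agree.snoc` with quantifier elimination: measures of meets with parameter terms
determine the whole type. -/
lemma tp_eq_of_meas_inf_eq {M N K : Type u} [MetricStructure N] [MetricStructure K] [IsAPA N]
    [IsAPA K] {C : Set M} {e : C → N} {e' : C → K}
    (h : Agree e e') {a : N} {b : K}
    (hab : ∀ t : Term C, meas (t.eval e ⊓ a) = meas (t.eval e' ⊓ b)) : tp e a = tp e' b := by
  have h1 : Agree (Sum.elim e (Fin.snoc Fin.elim0 a : Fin 1 → N))
      (Sum.elim e' (Fin.snoc Fin.elim0 b : Fin 1 → K)) := by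
    refine h.elim0.snoc fun t => ?_
    have h1 := hab (t.bind (Sum.elim .var Fin.elim0))
    rw [Term.eval_bind, Term.eval_bind] at h1
    convert h1 using 4 with i i <;>
    · funext i
      rcases i with a | i
      · rfl
      · exact i.elim0
  have h2 : ∀ {L : Type u} (c : L), (Fin.snoc Fin.elim0 c : Fin 1 → L) = ![c] := by
    intro L c
    funext i
    rw [Subsingleton.elim (α := Fin 1) i (Fin.last 0)]
    rfl
  rw [h2, h2] at h1
  ext φ
  exact (congrArg (· = 0) (h1.eval_eq φ)).to_iff

variable {M N : Type u} [MetricStructure M] [MetricStructure N] {C : Set M} {e : C → N}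

lemma IsModelOver.models (h : IsModelOver C N e) {T : Set Sentence} (hM : Models M T) :
    Models N T := by
  intro σ hσ
  have h1 := h (σ.map Empty.elim)
  rw [Formula.eval_map, Formula.eval_map] at h1
  rw [← hM σ hσ]
  convert h1

lemma IsModelOver.agree (h : IsModelOver C N e) : Agree (Subtype.val : C → M) e := by
  intro t
  have h1 := congrArg Subtype.val (h (.measure (t.bind fun c => .var (.inl c))))
  simp only [Formula.eval, Term.eval_bind] at h1
  exact h1.symm

lemma Agree.isModelOver [IsAPA M] [IsAPA N] (h : Agree (Subtype.val : C → M) e) :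
    IsModelOver C N e :=
  fun σ => (h.elim0.eval_eq σ).symm

end ModelsOver

section CantorModel

variable {ι : Type u} {ν : Measure (ι → Bool)}

lemma ext_of_cyl {ν' : Measure (ι → Bool)} [IsFiniteMeasure ν]
    (h : ∀ t : Term ι, ν (cyl t) = ν' (cyl t)) : ν = ν' := by
  refine ext_of_generate_finite _ generateFrom_range_cyl
    isSetRing_range_cyl.isSetSemiring.isPiSystem ?_ (h .one)
  rintro _ ⟨t, rfl⟩
  exact h t

variable [IsProbabilityMeasure ν]

variable (ν) in
/-- The generators of the algebra of the Cantor space, in the model over the measure `ν`. -/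
noncomputable def gen (i : ι) : MeasAlg (prodUnit ν) :=
  MeasAlg.mk _ (Prod.fst ⁻¹' cyl (.var i)) (measurable_fst (measurableSet_cyl _))

lemma eval_gen (t : Term ι) : t.eval (gen ν) =
    MeasAlg.mk _ (Prod.fst ⁻¹' cyl t) (measurable_fst (measurableSet_cyl t)) := by
  induction t with
  | var i => rfl
  | zero => rfl
  | one => rfl
  | compl t ih => exact congrArg MetricStructure.compl ih
  | inter s t ihs iht => exact congrArg₂ MetricStructure.inter ihs iht
  | union s t ihs iht => exact congrArg₂ MetricStructure.union ihs iht

lemma meas_mk {s : Set ((ι → Bool) × ℝ)} (hs : MeasurableSet s) :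
    meas (MeasAlg.mk (prodUnit ν) s hs) = (prodUnit ν).real s := rfl

lemma meas_eval_gen (t : Term ι) : meas (t.eval (gen ν)) = ν.real (cyl t) := by
  rw [eval_gen, meas_mk, ← Set.prod_univ, prodUnit, measureReal_prod_prod, probReal_univ, mul_one]

/-- Computes the length of a fibre of the region under a graph; the negative heights in the set are
null for the restricted measure. -/
lemma restrict_Icc_ofReal_lt {c : ℝ≥0∞} (hc : c ≤ 1) :
    volume.restrict (Set.Icc (0 : ℝ) 1) {t | ENNReal.ofReal t < c} = c := by
  lift c to NNReal using ne_top_of_le_ne_top ENNReal.one_ne_top hc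
  have hc' : (c : ℝ) ≤ 1 := by exact_mod_cast hc
  rw [Measure.restrict_apply (measurableSet_lt ENNReal.measurable_ofReal measurable_const)]
  have : {t : ℝ | ENNReal.ofReal t < c} ∩ Set.Icc 0 1 = Set.Ico 0 (c : ℝ) := by
    ext t
    simp only [Set.mem_inter_iff, Set.mem_ofPred_eq, Set.mem_Icc, Set.mem_Ico]
    rw [← ENNReal.ofReal_coe_nnreal]
    constructor
    · rintro ⟨h1, h2, -⟩
      exact ⟨h2, (ENNReal.ofReal_lt_ofReal_iff_of_nonneg h2).1 h1⟩
    · rintro ⟨h1, h2⟩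
      exact ⟨(ENNReal.ofReal_lt_ofReal_iff_of_nonneg h1).2 h2, h1, (h2.trans_le hc').le⟩
  rw [this, Real.volume_Ico, sub_zero, ENNReal.ofReal_coe_nnreal]

/-- The region under the graph of a density represents the measure with this density. -/
lemma exists_hypograph {X : Type u} [MeasurableSpace X] {ν ρ : Measure X}
    [IsProbabilityMeasure ν] [IsFiniteMeasure ρ] (h : ρ ≤ ν) :
    ∃ H, MeasurableSet H ∧ ∀ B, MeasurableSet B →
      (prodUnit ν) (Prod.fst ⁻¹' B ∩ H) = ρ B := by
  have hm : Measurable (ρ.rnDeriv ν) := Measure.measurable_rnDeriv ρ ν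
  have hH : MeasurableSet {p : X × ℝ | ENNReal.ofReal p.2 < ρ.rnDeriv ν p.1} :=
    measurableSet_lt (ENNReal.measurable_ofReal.comp measurable_snd) (hm.comp measurable_fst)
  refine ⟨_, hH, fun B hB => ?_⟩
  rw [prodUnit, Measure.prod_apply ((measurable_fst hB).inter hH)]
  have hac : ρ ≪ ν := Measure.absolutelyContinuous_of_le h
  conv_rhs => rw [← Measure.withDensity_rnDeriv_eq ρ ν hac, withDensity_apply _ hB,
    ← lintegral_indicator hB]
  refine lintegral_congr_ae ?_
  -- Since `ρ ≤ ν`, the density is at most 1 almost everywhere, so its graph fits inside the unit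
  -- interval.
  filter_upwards [Measure.rnDeriv_le_one_of_le h] with x hx
  by_cases hxB : x ∈ B
  · rw [Set.indicator_of_mem hxB, ← restrict_Icc_ofReal_lt hx]
    congr 1
    ext t
    simp [hxB]
  · rw [Set.indicator_of_notMem hxB]
    have : Prod.mk x ⁻¹' (Prod.fst ⁻¹' B ∩ {p : X × ℝ | ENNReal.ofReal p.2 < ρ.rnDeriv ν p.1})
        = ∅ := Set.eq_empty_of_forall_notMem fun t ht => hxB ht.1
    rw [this, measure_empty]

/-- The model over the Cantor space realizes every type over the generators. -/
lemma exists_realization {C N : Type u} [MetricStructure N] [IsAPA N] {ν : Measure (C → Bool)}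
    [IsProbabilityMeasure ν] {e : C → N} (h : Agree e (gen ν)) (a : N) :
    ∃ b : MeasAlg (prodUnit ν), ∀ t : Term C,
      meas (t.eval e ⊓ a) = meas (t.eval (gen ν) ⊓ b) := by
  have ex : ∀ c : N, ∃ ρ : Measure (C → Bool), ∀ t,
      ρ (cyl t) = ENNReal.ofReal (meas (t.eval e ⊓ c)) := fun c => by
    simp_rw [Term.eval_eq_bev]
    refine exists_measure_cyl e (fun x => ENNReal.ofReal (meas (x ⊓ c))) ?_ fun x y hxy => ?_
    · rw [bot_inf_eq, meas_bot, ENNReal.ofReal_zero]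
    · rw [inf_sup_right, meas_sup (hxy.mono inf_le_left inf_le_left),
        ENNReal.ofReal_add (meas_nonneg _) (meas_nonneg _)]
  obtain ⟨ρ, hρ⟩ := ex a
  -- The measure of `aᶜ` turns the comparison with `ν` into the identity `ν = ρ + ρ'`, which may be
  -- checked on cylinders, a generating π-system.
  obtain ⟨ρ', hρ'⟩ := ex aᶜ
  have hsum : ν = ρ + ρ' := by
    refine ext_of_cyl fun t => ?_
    rw [Measure.add_apply, hρ, hρ', ← ENNReal.ofReal_add (meas_nonneg _) (meas_nonneg _),
      meas_inf_add_inf_compl, h t, meas_eval_gen, ofReal_measureReal]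
  have hle : ρ ≤ ν := hsum ▸ Measure.le_add_right le_rfl
  have : IsFiniteMeasure ρ := isFiniteMeasure_of_le ν hle
  obtain ⟨H, hH, hB⟩ := exists_hypograph hle
  refine ⟨MeasAlg.mk _ H hH, fun t => ?_⟩
  rw [eval_gen]
  change _ = (prodUnit ν).real (Prod.fst ⁻¹' cyl t ∩ H)
  rw [Measure.real, hB _ (measurableSet_cyl t), hρ, ENNReal.toReal_ofReal (meas_nonneg _)]

lemma exists_agree_gen {C M : Type u} [MetricStructure M] [IsAPA M] (e : C → M) :
    ∃ (ν : Measure (C → Bool)) (_ : IsProbabilityMeasure ν), Agree e (gen ν) := by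
  obtain ⟨ν, hν⟩ := exists_measure_cyl e (fun x => ENNReal.ofReal (meas x))
    (by rw [meas_bot, ENNReal.ofReal_zero])
    fun x y hxy => by rw [meas_sup hxy, ENNReal.ofReal_add (meas_nonneg _) (meas_nonneg _)]
  have : IsProbabilityMeasure ν := ⟨(hν .one).trans (by
    change ENNReal.ofReal (meas (⊤ : M)) = 1
    rw [meas_top, ENNReal.ofReal_one])⟩
  refine ⟨ν, this, fun t => ?_⟩
  rw [meas_eval_gen, Measure.real, hν, ENNReal.toReal_ofReal (meas_nonneg _), Term.eval_eq_bev]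

end CantorModel

theorem omegaStable_APA : OmegaStable.{u} APA := by
  intro M _ hM C hC
  have : Countable C := hC.to_subtype
  have : IsAPA M := .of_models hM
  obtain ⟨ν, _, hν⟩ := exists_agree_gen (Subtype.val : C → M)
  obtain ⟨D, hDc, hD⟩ := TopologicalSpace.exists_countable_dense (MeasAlg (prodUnit ν))
  refine ⟨tp (gen ν) '' D, ?_, hDc.image _, ?_⟩
  · rintro _ ⟨b, -, rfl⟩
    exact ⟨_, _, gen ν, b, hν.isModelOver, rfl⟩
  · rintro p ⟨N, _, e, a, he, rfl⟩ ε hε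
    have : IsAPA N := .of_models (he.models hM)
    have hagree : Agree e (gen ν) := fun t => (he.agree t).symm.trans (hν t)
    obtain ⟨b, hb⟩ := exists_realization hagree a
    obtain ⟨c, hc, hbc⟩ := EMetric.mem_closure_iff.1 (hD b) ε hε
    refine ⟨_, ⟨c, hc, rfl⟩, lt_of_le_of_lt (sInf_le ?_) hbc⟩
    -- The realization `b` of `p` and the point `c` of the dense set lie in the same model, so their
    -- distance bounds that of the types.
    exact ⟨_, _, gen ν, b, c, hν.isModelOver, (tp_eq_of_meas_inf_eq hagree hb).symm, rfl, rfl⟩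

end ProbAlg

theorem proposition6p13 : ProbAlg.OmegaStable.{u} ProbAlg.APA := by
  exact ProbAlg.omegaStable_APA
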